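/- For elements $x,y$ of a group write $x^y=y^{-1}xy$ and $[x,y]=x^{-1}x^y$. For a group $G$, let $\varphi: G\to G^{\varphi}$, $g\mapsto g^{\varphi}$, be an isomorphism onto a copy of $G$, and let $$\nu(G)=\big\langle\, G\cup G^{\varphi}\ \big|\ [g_1,g_2^{\varphi}]^{g_3}=[g_1^{g_3},(g_2^{g_3})^{\varphi}]=[g_1,g_2^{\varphi}]^{g_3^{\varphi}}\ \text{ for all } g_1,g_2,g_3\in G\,\big\rangle ,$$ that is, the quotient of the free product of $G$ and $G^{\varphi}$ by these relations. A tensor is an element of $\nu(G)$ of the form $[g,h^{\varphi}]$ with $g,h\in G$. Theorem A. There is a function $f:\mathbb{N}\to\mathbb{N}$ such that the following holds for every positive integer $n$ and every group $G$: if for every tensor $x\in\nu(G)$ the conjugacy class $x^{\nu(G)}=\{x^{w} : w\in\nu(G)\}$ has at most $n$ elements, then the second derived subgroup $\nu(G)''$ is finite, of order at most $f(n)$. -/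

import Mathlib

namespace Rocco

/-- The right conjugate `x ^ y = y⁻¹ x y`. -/
def conjR {K : Type*} [Group K] (x y : K) : K := y⁻¹ * x * y

/-- The commutator `[x, y] = x⁻¹ x ^ y = x⁻¹ y⁻¹ x y`. -/
def commR {K : Type*} [Group K] (x y : K) : K := x⁻¹ * conjR x y

open Monoid.Coprod in
/-- The defining relators of `ν(G)` inside the free product of `G` and an isomorphic copy `G ^ φ`
of `G`. The left factor is `G`, the right factor is `G ^ φ`, and `g ^ φ` is `inr g`.
The relations are `[a, b ^ φ] ^ c = [a ^ c, (b ^ c) ^ φ] = [a, b ^ φ] ^ (c ^ φ)`. -/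
def nuRels (G : Type*) [Group G] : Set (Monoid.Coprod G G) :=
  {r | ∃ a b c : G,
    r = conjR (commR (inl a) (inr b)) (inl c) *
          (commR (inl (conjR a c)) (inr (conjR b c)))⁻¹ ∨
    r = conjR (commR (inl a) (inr b)) (inr c) *
          (commR (inl (conjR a c)) (inr (conjR b c)))⁻¹}

/-- The group `ν(G)`. -/
abbrev Nu (G : Type*) [Group G] : Type _ :=
  Monoid.Coprod G G ⧸ Subgroup.normalClosure (nuRels G)

/-- The canonical homomorphism `G → ν(G)`, `g ↦ g`. -/
def ι (G : Type*) [Group G] : G →* Nu G :=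
  (QuotientGroup.mk' (Subgroup.normalClosure (nuRels G))).comp Monoid.Coprod.inl

/-- The canonical homomorphism `G → ν(G)`, `g ↦ g ^ φ`. -/
def φ (G : Type*) [Group G] : G →* Nu G :=
  (QuotientGroup.mk' (Subgroup.normalClosure (nuRels G))).comp Monoid.Coprod.inr

/-- The set of tensors `{[g, h ^ φ] | g, h ∈ G}` in `ν(G)`. -/
def tensors (G : Type*) [Group G] : Set (Nu G) :=
  {x | ∃ g h : G, x = commR (ι G g) (φ G h)}

end Rocco

/-! Let α, β : G → ν(G) be the two canonical maps and T the subgroup generated by the tensors. Then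
T is normal, and α c and β c induce the same conjugation on T. So ⁅α a, β b⁆ acts on T as α ⁅a, b⁆
does, and centralizing conditions on tensors can be controlled by a and b modulo subgroups of finite
index in G.

The core is that T' is finite of bounded order (`exists_encard_commutator_le`). In a family of
tensors take x with the largest T-orbit. This orbit is already swept out by the subgroup generated
by some set F of at most n tensors. If w centralizes F and x * w stays in the family, maximality
forces the orbit of x * w to be the orbit of x translated by w, which puts ⁅T, w⁆ into the normal
subgroup generated by commutators of T with conjugates of x (the hull of x). Applied to all pairs
(a, b), and to pairs with one coordinate fixed, this yields boundedly many tensors modulo whose hull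
T is abelian. The hull lies in the derived subgroup of a group generated by boundedly many tensors,
so a form of Schur's theorem bounds it.

The same result for the identity maps of G bounds G''. Modulo T', the subgroups α(G'), β(G') and T
commute pairwise, so ν(G)'' lies in α(G'') β(G'') T'. -/

open scoped commutatorElement

/-! ### Bounded index, Schur's theorem and orbits -/

namespace Subgroup

variable {K L : Type*} [Group K] [Group L]

/-- The subgroup `H` has finite index, at most `c`. -/
def IndexAtMost (H : Subgroup K) (c : ℕ) : Prop := H.index ≠ 0 ∧ H.index ≤ c

namespace IndexAtMost

theorem mono {H : Subgroup K} {c d : ℕ} (h : H.IndexAtMost c) (hcd : c ≤ d) : H.IndexAtMost d :=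
  ⟨h.1, h.2.trans hcd⟩

theorem inf {H H' : Subgroup K} {c d : ℕ} (h : H.IndexAtMost c) (h' : H'.IndexAtMost d) :
    (H ⊓ H').IndexAtMost (c * d) :=
  ⟨index_inf_ne_zero h.1 h'.1, index_inf_le.trans (Nat.mul_le_mul h.2 h'.2)⟩

theorem iInf {I : Type*} [Finite I] {f : I → Subgroup K} {c : ℕ} (h : ∀ i, (f i).IndexAtMost c) :
    (⨅ i, f i).IndexAtMost (c ^ Nat.card I) := by
  have := Fintype.ofFinite I
  refine ⟨index_iInf_ne_zero fun i ↦ (h i).1, (index_iInf_le f).trans ?_⟩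
  rw [Nat.card_eq_fintype_card, ← Finset.card_univ]
  exact Finset.prod_le_pow_card _ _ _ fun i _ ↦ (h i).2

theorem comap {H : Subgroup K} {c : ℕ} (h : H.IndexAtMost c) (f : L →* K) :
    (H.comap f).IndexAtMost c := by
  rw [IndexAtMost, index_comap]
  have h0 : H.relIndex ⊤ ≠ 0 := by rw [relIndex_top_right]; exact h.1
  have h1 : H.relIndex f.range ≠ 0 := fun h' ↦ h.1 (index_eq_zero_of_relIndex_eq_zero h')
  refine ⟨h1, ?_⟩
  have := relIndex_le_of_le_right (le_top : f.range ≤ ⊤) h0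
  rw [relIndex_top_right] at this
  exact this.trans h.2

theorem normalCore {H : Subgroup K} {c : ℕ} (h : H.IndexAtMost c) :
    H.normalCore.IndexAtMost c.factorial := by
  have : H.FiniteIndex := ⟨h.1⟩
  refine ⟨FiniteIndex.index_ne_zero, ?_⟩
  have hd : H.normalCore.index ∣ H.index.factorial := by
    rw [normalCore_eq_ker, index_ker, index_eq_card, ← Nat.card_perm]
    exact card_subgroup_dvd_card _
  exact (Nat.le_of_dvd (Nat.factorial_pos _) hd).trans (Nat.factorial_le h.2)

end IndexAtMost

theorem indexAtMost_centralizer_singleton {x : K} {n : ℕ} (h : (conjugatesOf x).encard ≤ n) :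
    (centralizer {x}).IndexAtMost n := by
  have hi : (centralizer {x}).index = (conjugatesOf x).ncard := by
    have := MulAction.index_stabilizer (ConjAct K) x
    rw [ConjAct.stabilizer_eq_centralizer, ConjAct.orbit_eq_carrier_conjClasses] at this
    exact this
  have hf : (conjugatesOf x).Finite := Set.finite_of_encard_le_coe h
  have hne : (conjugatesOf x).ncard ≠ 0 :=
    Set.ncard_ne_zero_of_mem (mem_conjugatesOf_self) hf
  refine ⟨hi ▸ hne, hi ▸ ?_⟩
  rw [← hf.cast_ncard_eq] at h
  exact_mod_cast h

theorem indexAtMost_centralizer {S : Set K} {n s : ℕ} (hn : 0 < n) (hS : S.encard ≤ s)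
    (h : ∀ x ∈ S, (conjugatesOf x).encard ≤ n) : (centralizer S).IndexAtMost (n ^ s) := by
  have hf : S.Finite := Set.finite_of_encard_le_coe hS
  have := hf.to_subtype
  have he : centralizer S = ⨅ x : S, centralizer {(x : K)} := by
    ext k
    simp [mem_iInf, mem_centralizer_iff]
  rw [he]
  refine (IndexAtMost.iInf fun x : S ↦ indexAtMost_centralizer_singleton (h x x.2)).mono ?_
  rw [← hf.cast_ncard_eq] at hS
  exact Nat.pow_le_pow_right hn (by exact_mod_cast hS)

theorem cardCommutatorBound_mono {a b : ℕ} (ha : 0 < a) (hab : a ≤ b) :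
    cardCommutatorBound a ≤ cardCommutatorBound b := by
  have hb : 0 < b := ha.trans_le hab
  have h (k l : ℕ) (hkl : k ≤ l) : a ^ k ≤ b ^ l :=
    (Nat.pow_le_pow_left hab k).trans (Nat.pow_le_pow_right hb hkl)
  unfold cardCommutatorBound
  refine (Nat.pow_le_pow_left (h (2 * a) (2 * b) (by omega)) _).trans
    (Nat.pow_le_pow_right (Nat.pow_pos hb) ?_)
  have := h (2 * a + 1) (2 * b + 1) (by omega)
  omega

/-- A version of Schur's theorem: the derived subgroup of a group generated by `s` elements, each
with at most `n` conjugates, is finite of bounded order. -/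
theorem encard_commutator_closure_le {S : Set K} {n s : ℕ} (hn : 0 < n) (hS : S.encard ≤ s)
    (h : ∀ x ∈ S, (conjugatesOf x).encard ≤ n) :
    ((⁅closure S, closure S⁆ : Subgroup K) : Set K).encard ≤
      (cardCommutatorBound (n ^ s * n ^ s) : ℕ) := by
  obtain ⟨h0, h1⟩ := indexAtMost_centralizer hn hS h
  set D := centralizer S with hD
  have hfin : Finite (K ⧸ D) := (Nat.card_ne_zero.mp h0).2
  set T := closure S with hT
  have hDT : D ≤ centralizer T := by rw [hD, hT, centralizer_closure]
  -- As D centralizes T, a commutator in T depends only on the cosets of its entries modulo D, so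
  -- there are at most (n ^ s) ^ 2 commutators.
  have hcom (a b a' b' : T) (ha : ((a : K) : K ⧸ D) = (a' : K)) (hb : ((b : K) : K ⧸ D) = (b' : K)) :
      ⁅(a : K), (b : K)⁆ = ⁅(a' : K), (b' : K)⁆ := by
    have ha' := mem_centralizer_iff.mp (hDT (QuotientGroup.eq.mp ha))
    have hb' := mem_centralizer_iff.mp (hDT (QuotientGroup.eq.mp hb))
    have e1 : ⁅(a : K), (b : K)⁆ = ⁅(a' : K), (b : K)⁆ := by
      have := ha' b b.2
      have e : (a' : K) = a * ((a : K)⁻¹ * a') := by group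
      rw [e, commutatorElement_mul_left_eq_conj_mul,
        commutatorElement_eq_one_iff_mul_comm.mpr this.symm]
      simp
    have e2 : ⁅(a' : K), (b : K)⁆ = ⁅(a' : K), (b' : K)⁆ := by
      have := hb' a' a'.2
      have e : (b' : K) = b * ((b : K)⁻¹ * b') := by group
      rw [e, commutatorElement_mul_right_eq_mul_conj,
        commutatorElement_eq_one_iff_mul_comm.mpr this]
      simp
    rw [e1, e2]
  let f : commutatorSet T → (K ⧸ D) × (K ⧸ D) := fun x ↦
    (((x.2.choose : T) : K), ((x.2.choose_spec.choose : T) : K))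
  have hf : Function.Injective f := by
    intro x y hxy
    have hx := x.2.choose_spec.choose_spec
    have hy := y.2.choose_spec.choose_spec
    obtain ⟨h1, h2⟩ := Prod.ext_iff.mp hxy
    exact Subtype.ext (hx.symm.trans ((Subtype.ext (hcom _ _ _ _ h1 h2)).trans hy))
  have : Finite (commutatorSet T) := Finite.of_injective f hf
  have hle : Nat.card (commutatorSet T) ≤ n ^ s * n ^ s := by
    refine (Nat.card_le_card_of_injective f hf).trans ?_
    rw [Nat.card_prod]
    exact Nat.mul_le_mul h1 h1
  have hcard := (card_commutator_le_of_finite_commutatorSet T).trans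
    (cardCommutatorBound_mono Nat.card_pos hle)
  rw [← map_subtype_commutator, coe_map]
  refine (Set.encard_image_le _ _).trans ?_
  have hfin' : Finite (_root_.commutator T) := inferInstance
  rw [← Set.Finite.cast_ncard_eq (s := (_root_.commutator T : Set T)) hfin']
  exact_mod_cast hcard

/-- If `x` has at most `n` conjugates, then its orbit under `closure X` is already its orbit under
the subgroup generated by some `n` elements of `X`. -/
theorem exists_encard_le_forall_conj_eq {x : K} {n : ℕ} (X : Set K)
    (hx : (conjugatesOf x).encard ≤ n) :
    ∃ F ⊆ X, F.encard ≤ n ∧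
      ∀ h ∈ closure X, ∃ b ∈ closure F, b * x * b⁻¹ = h * x * h⁻¹ := by
  let O : Set K → Set K := fun F ↦ (fun b ↦ b * x * b⁻¹) '' (closure F : Set K)
  -- Add elements of X one at a time while the orbit grows: with j elements it is complete or has
  -- more than j points. The latter is impossible for j = n.
  have key (j : ℕ) : ∃ F ⊆ X, F.encard ≤ j ∧
      ((∀ h ∈ closure X, h * x * h⁻¹ ∈ O F) ∨ (j : ℕ∞) < (O F).encard) := by
    induction j with
    | zero =>
      refine ⟨∅, Set.empty_subset _, by simp, Or.inr ?_⟩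
      rw [Nat.cast_zero, Set.encard_pos]
      exact ⟨x, 1, one_mem _, by simp⟩
    | succ j ih =>
      obtain ⟨F, hFX, hF, hc | hlt⟩ := ih
      · exact ⟨F, hFX, hF.trans (by exact_mod_cast Nat.le_succ j), Or.inl hc⟩
      by_cases hex : ∃ y ∈ X, O (insert y F) ≠ O F
      · obtain ⟨y, hy, hne⟩ := hex
        refine ⟨insert y F, Set.insert_subset hy hFX, ?_, Or.inr ?_⟩
        · refine (Set.encard_insert_le _ _).trans ?_
          push_cast
          gcongr
        · have hss : O F ⊂ O (insert y F) :=
            (Set.image_mono (closure_mono (Set.subset_insert _ _))).ssubset_of_ne hne.symm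
          by_cases hfin : (O F).Finite
          · have := hfin.encard_lt_encard hss
            refine lt_of_lt_of_le ?_ (Order.add_one_le_of_lt this)
            push_cast
            exact (ENat.add_lt_add_iff_right ENat.one_ne_top).mpr hlt
          · have : (O (insert y F)).Infinite := Set.Infinite.mono hss.subset hfin
            rw [this.encard_eq]
            exact ENat.natCast_lt_top _
      · push Not at hex
        refine ⟨F, hFX, hF.trans (by exact_mod_cast Nat.le_succ j), Or.inl ?_⟩
        -- No single element of X enlarges the orbit, so it is stable under X. Both directions of
        -- conjugation are kept so that the induction passes through inverses.
        have hinv : ∀ h ∈ closure X, (∀ z ∈ O F, h * z * h⁻¹ ∈ O F ∧ h⁻¹ * z * h ∈ O F) := by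
          intro h hh
          induction hh using closure_induction with
          | mem y hy =>
            rintro _ ⟨b, hb, rfl⟩
            have hy' : y ∈ closure (insert y F) := subset_closure (Set.mem_insert _ _)
            have hb' : b ∈ closure (insert y F) := closure_mono (Set.subset_insert _ _) hb
            rw [← hex y hy]
            exact ⟨⟨y * b, mul_mem hy' hb', by simp [mul_assoc]⟩,
              ⟨y⁻¹ * b, mul_mem (inv_mem hy') hb', by simp [mul_assoc]⟩⟩
          | one => intro z hz; simpa using hz
          | mul g g' _ _ hg hg' =>
            intro z hz
            have h1 := (hg _ (hg' z hz).1).1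
            have h2 := (hg' _ (hg z hz).2).2
            constructor
            · convert h1 using 1; group
            · convert h2 using 1; group
          | inv g _ hg => intro z hz; simpa using (hg z hz).symm
        exact fun h hh ↦ (hinv h hh x ⟨1, one_mem _, by simp⟩).1
  obtain ⟨F, hFX, hF, hc | hlt⟩ := key n
  · exact ⟨F, hFX, hF, hc⟩
  · refine absurd (hlt.trans_le (Set.encard_le_encard ?_)) hx.not_gt
    rintro _ ⟨b, _, rfl⟩
    exact isConj_iff.mpr ⟨b, rfl⟩

end Subgroup

namespace Set

theorem encard_biUnion_le {I M : Type*} {S : Set I} {f : I → Set M} {s n : ℕ}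
    (hS : S.encard ≤ s) (hf : ∀ i ∈ S, (f i).encard ≤ n) : (⋃ i ∈ S, f i).encard ≤ (s * n : ℕ) := by
  have hfin : S.Finite := finite_of_encard_le_coe hS
  have key : (⋃ i ∈ S, f i).encard ≤ S.encard * n := by
    clear hS
    induction S, hfin using Set.Finite.induction_on with
    | empty => simp
    | insert ha _ ih =>
      rw [biUnion_insert, encard_insert_of_notMem ha, add_mul, one_mul, add_comm]
      exact (encard_union_le _ _).trans
        (add_le_add (hf _ (mem_insert _ _)) (ih fun i hi ↦ hf i (mem_insert_of_mem _ hi)))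
  push_cast
  exact key.trans (mul_le_mul_left hS _)

end Set

/-! ### Commutator hulls and the maximal orbit argument -/

namespace Subgroup

variable {K : Type*} [Group K]

/-- The subgroup generated by the commutators of elements of `H` with conjugates of elements
of `Y`. -/
def commutatorHull (H : Subgroup K) (Y : Set K) : Subgroup K :=
  closure {g | ∃ h ∈ H, ∃ y ∈ Group.conjugatesOfSet Y, ⁅h, y⁆ = g}

theorem commutator_mem_commutatorHull {H : Subgroup K} {Y : Set K} {h y : K} (hh : h ∈ H)
    (hy : y ∈ Y) : ⁅h, y⁆ ∈ commutatorHull H Y :=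
  subset_closure ⟨h, hh, y, Group.subset_conjugatesOfSet hy, rfl⟩

theorem commutatorHull_mono {H : Subgroup K} {Y Y' : Set K} (h : Y ⊆ Y') :
    commutatorHull H Y ≤ commutatorHull H Y' := by
  apply closure_mono
  rintro _ ⟨g, hg, y, hy, rfl⟩
  exact ⟨g, hg, y, Group.conjugatesOfSet_mono h hy, rfl⟩

instance commutatorHull_normal (H : Subgroup K) [hH : H.Normal] (Y : Set K) :
    (commutatorHull H Y).Normal := by
  refine ⟨fun x hx k ↦ ?_⟩
  induction hx using closure_induction with
  | mem x hx =>
    obtain ⟨h, hh, y, hy, rfl⟩ := hx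
    rw [conjugate_commutatorElement]
    exact subset_closure ⟨_, hH.conj_mem h hh k, _, Group.conj_mem_conjugatesOfSet hy, rfl⟩
  | one => simp
  | mul x y _ _ hx hy =>
    have := mul_mem hx hy
    convert this using 1
    group
  | inv x _ hx =>
    have := inv_mem hx
    convert this using 1
    group

/-- The preimage in `K` of the centralizer of `H` modulo `commutatorHull H Y`. -/
def hullCentralizer (H : Subgroup K) [H.Normal] (Y : Set K) : Subgroup K :=
  (centralizer (H.map (QuotientGroup.mk' (commutatorHull H Y)) : Set _)).comap
    (QuotientGroup.mk' (commutatorHull H Y))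

instance hullCentralizer_normal (H : Subgroup K) [hH : H.Normal] (Y : Set K) :
    (hullCentralizer H Y).Normal := by
  have : (H.map (QuotientGroup.mk' (commutatorHull H Y))).Normal :=
    hH.map _ (QuotientGroup.mk'_surjective _)
  unfold hullCentralizer
  infer_instance

theorem mem_hullCentralizer {H : Subgroup K} [H.Normal] {Y : Set K} {k : K} :
    k ∈ hullCentralizer H Y ↔ ∀ h ∈ H, ⁅h, k⁆ ∈ commutatorHull H Y := by
  simp only [hullCentralizer, mem_comap, mem_centralizer_iff, SetLike.mem_coe, mem_map,
    forall_exists_index, and_imp, forall_apply_eq_imp_iff₂]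
  refine forall₂_congr fun h _ ↦ ?_
  rw [← commutatorElement_eq_one_iff_mul_comm, ← map_commutatorElement]
  exact QuotientGroup.eq_one_iff _

theorem hullCentralizer_mono {H : Subgroup K} [H.Normal] {Y Y' : Set K} (h : Y ⊆ Y') :
    hullCentralizer H Y ≤ hullCentralizer H Y' := fun _ hk ↦
  mem_hullCentralizer.mpr fun g hg ↦ commutatorHull_mono h (mem_hullCentralizer.mp hk g hg)

theorem subset_hullCentralizer {H : Subgroup K} [H.Normal] {Y : Set K} :
    Y ⊆ hullCentralizer H Y := fun _ hy ↦
  mem_hullCentralizer.mpr fun _ hg ↦ commutator_mem_commutatorHull hg hy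

/-- If `Y` consists of `s` elements of a normal subset `X` all of whose elements have at most `n`
conjugates, then the commutator hull of `Y` is finite of bounded order. -/
theorem encard_commutatorHull_le {X Y : Set K} {n s : ℕ} (hn : 0 < n)
    (hX : ∀ x ∈ X, ∀ k : K, k * x * k⁻¹ ∈ X) (hXn : ∀ x ∈ X, (conjugatesOf x).encard ≤ n)
    (hY : Y ⊆ X) (hYs : Y.encard ≤ s) :
    ((commutatorHull (closure X) Y : Subgroup K) : Set K).encard ≤
      (cardCommutatorBound (n ^ (s * n * n + s * n) * n ^ (s * n * n + s * n)) : ℕ) := by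
  set Z := Group.conjugatesOfSet Y with hZ
  have hZX : Z ⊆ X := by
    intro z hz
    obtain ⟨y, hy, hyz⟩ := Group.mem_conjugatesOfSet_iff.mp hz
    obtain ⟨k, rfl⟩ := isConj_iff.mp hyz
    exact hX y (hY hy) k
  have hZs : Z.encard ≤ (s * n : ℕ) := Set.encard_biUnion_le hYs fun y hy ↦ hXn y (hY hy)
  have hex (z : K) : ∃ F ⊆ X, z ∈ Z → F.encard ≤ n ∧
      ∀ h ∈ closure X, ∃ b ∈ closure F, b * z * b⁻¹ = h * z * h⁻¹ := by
    by_cases hz : z ∈ Z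
    · obtain ⟨F, hF, h⟩ := exists_encard_le_forall_conj_eq X (hXn z (hZX hz))
      exact ⟨F, hF, fun _ ↦ h⟩
    · exact ⟨∅, Set.empty_subset _, fun h ↦ absurd h hz⟩
  choose F hFX hF using hex
  -- There are at most s * n conjugates z, each with at most n elements in F z. Every generator ⁅h,
  -- z⁆ of the hull equals some ⁅b, z⁆ with b in the closure of F z, hence is a commutator in the
  -- closure of S.
  set S := (⋃ z ∈ Z, F z) ∪ Z with hS
  have hSX : S ⊆ X := Set.union_subset (Set.iUnion₂_subset fun z _ ↦ hFX z) hZX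
  have hSs : S.encard ≤ (s * n * n + s * n : ℕ) := by
    refine (Set.encard_union_le _ _).trans ?_
    rw [Nat.cast_add]
    exact add_le_add (Set.encard_biUnion_le hZs fun z hz ↦ (hF z hz).1) hZs
  refine le_trans (Set.encard_le_encard ?_)
    (encard_commutator_closure_le hn hSs fun x hx ↦ hXn x (hSX hx))
  refine (closure_le _).mpr ?_
  rintro _ ⟨h, hh, z, hz, rfl⟩
  obtain ⟨b, hb, e⟩ := (hF z hz).2 h hh
  have hb' : b ∈ closure S :=
    closure_mono (Set.subset_union_of_subset_left (Set.subset_biUnion_of_mem hz) _) hb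
  have hzS : z ∈ closure S := subset_closure (Set.mem_union_right _ hz)
  have : ⁅h, z⁆ = ⁅b, z⁆ := by rw [commutatorElement_def, commutatorElement_def, e]
  rw [this]
  exact commutator_mem_commutator hb' hzS

/-- In any nonempty `P ⊆ X` there is an element `a` such that every `w` with `a * w ∈ P` which
centralizes a suitable set of `n` elements of `X` centralizes `closure X` modulo the commutator
hull of `a`. -/
theorem exists_mem_forall_mem_hullCentralizer {X P : Set K} {n : ℕ} [(closure X).Normal]
    (hXn : ∀ x ∈ X, (conjugatesOf x).encard ≤ n) (hP : P ⊆ X) (hne : P.Nonempty) :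
    ∃ a ∈ P, ∃ F ⊆ X, F.encard ≤ n ∧
      ∀ w ∈ centralizer F, a * w ∈ P → w ∈ hullCentralizer (closure X) {a} := by
  let O : K → Set K := fun a ↦ (fun h ↦ h * a * h⁻¹) '' (closure X : Set K)
  have hO (a : K) (ha : a ∈ P) : (O a).Finite ∧ (O a).ncard ≤ n := by
    have hsub : O a ⊆ conjugatesOf a := by
      rintro _ ⟨h, _, rfl⟩
      exact isConj_iff.mpr ⟨h, rfl⟩
    have hle := (Set.encard_le_encard hsub).trans (hXn a (hP ha))
    have hfin := Set.finite_of_encard_le_coe hle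
    rw [← hfin.cast_ncard_eq] at hle
    exact ⟨hfin, by exact_mod_cast hle⟩
  have hbdd : BddAbove ((fun a ↦ (O a).ncard) '' P) := ⟨n, by
    rintro _ ⟨a, ha, rfl⟩
    exact (hO a ha).2⟩
  obtain ⟨a, ha, hmax⟩ := Nat.sSup_mem (hne.image fun a ↦ (O a).ncard) hbdd
  have hmax' (b : K) (hb : b ∈ P) : (O b).ncard ≤ (O a).ncard := by
    have := le_csSup hbdd (Set.mem_image_of_mem (fun a ↦ (O a).ncard) hb)
    rw [← hmax] at this
    exact this
  obtain ⟨F, hFX, hF, hFc⟩ := exists_encard_le_forall_conj_eq X (hXn a (hP ha))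
  refine ⟨a, ha, F, hFX, hF, fun w hw haw ↦ mem_hullCentralizer.mpr fun h hh ↦ ?_⟩
  rw [← centralizer_closure] at hw
  -- Each point of the orbit of a is b * a * b⁻¹ with b in the closure of F. Such b commutes with w,
  -- so it takes a * w to (b * a * b⁻¹) * w.
  have hsub : (fun z ↦ z * w) '' O a ⊆ O (a * w) := by
    rintro _ ⟨_, ⟨g, hg, rfl⟩, rfl⟩
    obtain ⟨b, hb, e⟩ := hFc g hg
    refine ⟨b, closure_mono hFX hb, ?_⟩
    have hc := mem_centralizer_iff.mp hw b hb
    simp only [← e]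
    rw [← mul_assoc, mul_assoc (b * a), ← Commute.eq (Commute.inv_left hc), ← mul_assoc]
  have heq : (fun z ↦ z * w) '' O a = O (a * w) := by
    refine Set.eq_of_subset_of_ncard_le hsub ?_ (hO _ haw).1
    rw [Set.ncard_image_of_injective _ (mul_left_injective w)]
    exact hmax' _ haw
  have hmem : h * (a * w) * h⁻¹ ∈ (fun z ↦ z * w) '' O a := heq ▸ ⟨h, hh, rfl⟩
  obtain ⟨_, ⟨b, hb, rfl⟩, e⟩ := hmem
  have e1 : ⁅h, w⁆ = a⁻¹ * (⁅h, a⁆⁻¹ * ⁅b, a⁆) * a⁻¹⁻¹ := by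
    have e2 : h * w * h⁻¹ = (h * a * h⁻¹)⁻¹ * (b * a * b⁻¹ * w) := by
      simp only at e
      rw [e]; group
    rw [commutatorElement_def, e2]
    simp only [commutatorElement_def]
    group
  rw [e1]
  refine (commutatorHull_normal _ _).conj_mem _ (mul_mem (inv_mem ?_) ?_) _
  · exact commutator_mem_commutatorHull hh rfl
  · exact commutator_mem_commutatorHull hb rfl

end Subgroup

/-! ### Commutators modulo a normal subgroup -/

namespace Subgroup

variable {K G : Type*} [Group K] [Group G]

/-- Removes a base point a: expanding ⁅a * b, c⁆ shows that the given product is conjugate to ⁅b,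
c⁆. -/
theorem commutatorElement_mem_of_mul_left {Z : Subgroup K} [hZ : Z.Normal] {a b c : K}
    (h : ⁅a, c⁆⁻¹ * ⁅a * b, c⁆ ∈ Z) : ⁅b, c⁆ ∈ Z := by
  have h1 := hZ.conj_mem _ (hZ.conj_mem _ h ⁅a, c⁆) a⁻¹
  rw [commutatorElement_mul_left_eq_conj_mul] at h1
  convert h1 using 1
  group

theorem commutatorElement_mem_of_mul_right {Z : Subgroup K} [hZ : Z.Normal] {a b c : K}
    (h : ⁅a, b⁆⁻¹ * ⁅a, b * c⁆ ∈ Z) : ⁅a, c⁆ ∈ Z := by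
  have h1 := hZ.conj_mem _ h b⁻¹
  rw [commutatorElement_mul_right_eq_mul_conj] at h1
  convert h1 using 1
  group

theorem commutatorElement_mul_left_mem {Z : Subgroup K} [hZ : Z.Normal] {a b c : K}
    (ha : ⁅a, c⁆ ∈ Z) (hb : ⁅b, c⁆ ∈ Z) : ⁅a * b, c⁆ ∈ Z := by
  rw [commutatorElement_mul_left_eq_conj_mul]
  exact mul_mem (hZ.conj_mem _ hb a) ha

theorem commutatorElement_mul_right_mem {Z : Subgroup K} [hZ : Z.Normal] {a b c : K}
    (hb : ⁅a, b⁆ ∈ Z) (hc : ⁅a, c⁆ ∈ Z) : ⁅a, b * c⁆ ∈ Z := by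
  rw [commutatorElement_mul_right_eq_mul_conj, mul_assoc, mul_assoc, ← mul_assoc b]
  exact mul_mem hb (hZ.conj_mem _ hc b)

theorem exists_eq_out_mul (U : Subgroup G) (g : G) :
    ∃ i : G ⧸ U, ∃ u ∈ U, g = i.out * u := by
  obtain ⟨u, hu⟩ := QuotientGroup.mk_out_eq_mul U g
  exact ⟨g, (u : G)⁻¹, inv_mem u.2, by rw [hu]; group⟩

end Subgroup

theorem Set.encard_range_le_of_card_le {I M : Type*} [Finite I] (f : I → M) {c : ℕ}
    (h : Nat.card I ≤ c) : (Set.range f).encard ≤ c := by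
  rw [← Set.image_univ]
  refine (Set.encard_image_le _ _).trans ?_
  rw [Set.encard_univ, ENat.card_eq_coe_natCard]
  exact_mod_cast h

/-- Two homomorphisms `α` and `β` into a group generated by their ranges are compatible if
conjugation by `α c` and by `β c` both map `⁅α a, β b⁆` to `⁅α (c a c⁻¹), β (c b c⁻¹)⁆`. -/
structure CompatiblePair {K G : Type*} [Group K] [Group G] (α β : G →* K) : Prop where
  conj_left : ∀ a b c, α c * ⁅α a, β b⁆ * (α c)⁻¹ = ⁅α (c * a * c⁻¹), β (c * b * c⁻¹)⁆
  conj_right : ∀ a b c, β c * ⁅α a, β b⁆ * (β c)⁻¹ = ⁅α (c * a * c⁻¹), β (c * b * c⁻¹)⁆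
  range_sup_range : α.range ⊔ β.range = ⊤

/-- The set of commutators `⁅α a, β b⁆`. -/
def crossCommutators {K G : Type*} [Group K] [Group G] (α β : G →* K) : Set K :=
  {x | ∃ a b, ⁅α a, β b⁆ = x}

/-! ### Derived subgroup of the subgroup generated by cross commutators -/

namespace CompatiblePair

open Subgroup

variable {K G : Type*} [Group K] [Group G] {α β : G →* K}

theorem conj_mem_crossCommutators (h : CompatiblePair α β) {x : K}
    (hx : x ∈ crossCommutators α β) (k : K) : k * x * k⁻¹ ∈ crossCommutators α β := by
  have hk : k ∈ α.range ⊔ β.range := h.range_sup_range ▸ mem_top k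
  rw [sup_eq_closure] at hk
  suffices H : ∀ y ∈ crossCommutators α β,
      k * y * k⁻¹ ∈ crossCommutators α β ∧ k⁻¹ * y * k ∈ crossCommutators α β from (H x hx).1
  clear hx x
  induction hk using closure_induction with
  | mem k hk =>
    rintro _ ⟨a, b, rfl⟩
    rcases hk with ⟨c, rfl⟩ | ⟨c, rfl⟩
    · have h1 := h.conj_left a b c⁻¹
      rw [map_inv, inv_inv] at h1
      exact ⟨⟨_, _, (h.conj_left a b c).symm⟩, ⟨_, _, h1.symm⟩⟩
    · have h1 := h.conj_right a b c⁻¹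
      rw [map_inv, inv_inv] at h1
      exact ⟨⟨_, _, (h.conj_right a b c).symm⟩, ⟨_, _, h1.symm⟩⟩
  | one => intro y hy; simpa using hy
  | mul g g' _ _ hg hg' =>
    intro z hz
    have h1 := (hg _ (hg' z hz).1).1
    have h2 := (hg' _ (hg z hz).2).2
    constructor
    · convert h1 using 1; group
    · convert h2 using 1; group
  | inv g _ hg => intro z hz; simpa using (hg z hz).symm

theorem normal_closure (h : CompatiblePair α β) : (closure (crossCommutators α β)).Normal := by
  have he : Group.conjugatesOfSet (crossCommutators α β) = crossCommutators α β := by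
    refine Set.Subset.antisymm (fun y hy ↦ ?_) Group.subset_conjugatesOfSet
    obtain ⟨x, hx, hxy⟩ := Group.mem_conjugatesOfSet_iff.mp hy
    obtain ⟨k, rfl⟩ := isConj_iff.mp hxy
    exact h.conj_mem_crossCommutators hx k
  have : (normalClosure (crossCommutators α β)).Normal := normalClosure_normal
  rwa [normalClosure, he] at this

theorem inv_mul_mem_centralizer (h : CompatiblePair α β) (c : G) :
    (α c)⁻¹ * β c ∈ centralizer (closure (crossCommutators α β) : Set K) := by
  rw [centralizer_closure, mem_centralizer_iff]
  rintro _ ⟨a, b, rfl⟩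
  have := (h.conj_left a b c).trans (h.conj_right a b c).symm
  have e := congrArg (fun z ↦ (α c)⁻¹ * z * β c) this
  group at e ⊢
  exact e

/-- On `closure (crossCommutators α β)`, conjugation by `⁅α a, β b⁆` agrees with conjugation by
`α ⁅a, b⁆`. -/
theorem inv_mul_commutator_mem_centralizer (h : CompatiblePair α β) (a b : G) :
    (α ⁅a, b⁆)⁻¹ * ⁅α a, β b⁆ ∈ centralizer (closure (crossCommutators α β) : Set K) := by
  have := h.normal_closure
  rw [← QuotientGroup.eq, map_commutatorElement]
  have e := QuotientGroup.eq.mpr (h.inv_mul_mem_centralizer b)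
  change QuotientGroup.mk' _ ⁅α a, α b⁆ = QuotientGroup.mk' _ ⁅α a, β b⁆
  rw [map_commutatorElement, map_commutatorElement]
  exact congrArg (fun z ↦ ⁅QuotientGroup.mk' _ (α a), z⁆) e

variable {n : ℕ}

/-- The orbit argument in terms of G. With U the normal core of the α-preimage of the centralizer of
F, pairs congruent modulo U have commutators in G congruent modulo U. The quotient of the two cross
commutators acts on the closure like the α-image of an element of U, so it centralizes F. -/
theorem exists_mem_forall_mem_hullCentralizer (h : CompatiblePair α β)
    [(closure (crossCommutators α β)).Normal] (hn : 0 < n)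
    (hXn : ∀ x ∈ crossCommutators α β, (conjugatesOf x).encard ≤ n) {P : Set (G × G)}
    (hP : P.Nonempty) :
    ∃ p ∈ P, ∃ U : Subgroup G, U.Normal ∧ U.IndexAtMost (n ^ n).factorial ∧ ∀ q ∈ P,
      p.1⁻¹ * q.1 ∈ U → p.2⁻¹ * q.2 ∈ U → ⁅α p.1, β p.2⁆⁻¹ * ⁅α q.1, β q.2⁆ ∈
        hullCentralizer (closure (crossCommutators α β)) {⁅α p.1, β p.2⁆} := by
  obtain ⟨_, ⟨p, hp, rfl⟩, F, hFX, hF, hw⟩ :=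
    Subgroup.exists_mem_forall_mem_hullCentralizer (P := (fun p ↦ ⁅α p.1, β p.2⁆) '' P) hXn
      (by rintro _ ⟨p, _, rfl⟩; exact ⟨_, _, rfl⟩) (hP.image _)
  refine ⟨p, hp, ((centralizer F).comap α).normalCore, inferInstance,
    ((indexAtMost_centralizer hn hF fun x hx ↦ hXn x (hFX hx)).comap α).normalCore, ?_⟩
  intro q hq h1 h2
  set U := ((centralizer F).comap α).normalCore with hU
  refine hw _ ?_ ⟨q, hq, (mul_inv_cancel_left _ _).symm⟩
  set C := centralizer (closure (crossCommutators α β) : Set K) with hC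
  have hCF : C ≤ centralizer F := centralizer_le (hFX.trans subset_closure)
  have hu : ⁅p.1, p.2⁆⁻¹ * ⁅q.1, q.2⁆ ∈ U := by
    rw [← QuotientGroup.eq] at h1 h2 ⊢
    change QuotientGroup.mk' U _ = QuotientGroup.mk' U _
    rw [map_commutatorElement, map_commutatorElement]
    exact congrArg₂ (fun x y : G ⧸ U ↦ ⁅x, y⁆) h1 h2
  have hu' : α (⁅p.1, p.2⁆⁻¹ * ⁅q.1, q.2⁆) ∈ centralizer F :=
    normalCore_le ((centralizer F).comap α) hu
  have hc : (α (⁅p.1, p.2⁆⁻¹ * ⁅q.1, q.2⁆))⁻¹ * (⁅α p.1, β p.2⁆⁻¹ * ⁅α q.1, β q.2⁆) ∈ C := by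
    have e1 := QuotientGroup.eq.mpr (h.inv_mul_commutator_mem_centralizer p.1 p.2)
    have e2 := QuotientGroup.eq.mpr (h.inv_mul_commutator_mem_centralizer q.1 q.2)
    rw [← QuotientGroup.eq, map_mul, map_inv, QuotientGroup.mk_mul, QuotientGroup.mk_mul,
      QuotientGroup.mk_inv, QuotientGroup.mk_inv, e1, e2]
  have := mul_mem hu' (hCF hc)
  rwa [mul_inv_cancel_left] at this

theorem exists_forall_left_mem_hullCentralizer (h : CompatiblePair α β)
    [(closure (crossCommutators α β)).Normal] (hn : 0 < n)
    (hXn : ∀ x ∈ crossCommutators α β, (conjugatesOf x).encard ≤ n) (g : G) :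
    ∃ y ∈ crossCommutators α β, ∃ U : Subgroup G, U.Normal ∧ U.IndexAtMost (n ^ n).factorial ∧
      ∀ v ∈ U, ⁅α g, β v⁆ ∈ hullCentralizer (closure (crossCommutators α β)) {y} := by
  obtain ⟨⟨g', e⟩, hp, U, hU, hUi, H⟩ := h.exists_mem_forall_mem_hullCentralizer hn hXn
    (P := {p | p.1 = g}) ⟨(g, 1), rfl⟩
  obtain rfl : g' = g := hp
  refine ⟨⁅α g', β e⁆, ⟨_, _, rfl⟩, U, hU, hUi, fun v hv ↦
    commutatorElement_mem_of_mul_right (b := β e) ?_⟩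
  rw [← map_mul]
  exact H (g', e * v) rfl (by simp) (by simpa using hv)

theorem exists_forall_right_mem_hullCentralizer (h : CompatiblePair α β)
    [(closure (crossCommutators α β)).Normal] (hn : 0 < n)
    (hXn : ∀ x ∈ crossCommutators α β, (conjugatesOf x).encard ≤ n) (g : G) :
    ∃ y ∈ crossCommutators α β, ∃ U : Subgroup G, U.Normal ∧ U.IndexAtMost (n ^ n).factorial ∧
      ∀ v ∈ U, ⁅α v, β g⁆ ∈ hullCentralizer (closure (crossCommutators α β)) {y} := by
  obtain ⟨⟨d, g'⟩, hp, U, hU, hUi, H⟩ := h.exists_mem_forall_mem_hullCentralizer hn hXn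
    (P := {p | p.2 = g}) ⟨(1, g), rfl⟩
  obtain rfl : g' = g := hp
  refine ⟨⁅α d, β g'⁆, ⟨_, _, rfl⟩, U, hU, hUi, fun v hv ↦
    commutatorElement_mem_of_mul_left (a := α d) ?_⟩
  rw [← map_mul]
  exact H (d * v, g') rfl (by simpa using hv) (by simp)

theorem exists_forall_mem_hullCentralizer (h : CompatiblePair α β)
    [(closure (crossCommutators α β)).Normal] (hn : 0 < n)
    (hXn : ∀ x ∈ crossCommutators α β, (conjugatesOf x).encard ≤ n) :
    ∃ y ∈ crossCommutators α β, ∃ U : Subgroup G, U.Normal ∧ U.IndexAtMost (n ^ n).factorial ∧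
      ∀ u ∈ U, ∀ v ∈ U,
        ⁅α u, β v⁆ ∈ hullCentralizer (closure (crossCommutators α β)) {y} := by
  obtain ⟨⟨d, e⟩, -, U, hU, hUi, H⟩ := h.exists_mem_forall_mem_hullCentralizer hn hXn
    (P := Set.univ) Set.univ_nonempty
  -- Compare the corners (d, e), (d * u, e), (d, e * v), (d * u, e * v): first d is removed, giving
  -- u against e and against e * v, then e.
  refine ⟨⁅α d, β e⁆, ⟨_, _, rfl⟩, U, hU, hUi, fun u hu v hv ↦ ?_⟩
  have h1 := H (d * u, e) trivial (by simpa using hu) (by simp)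
  have h2 := H (d, e * v) trivial (by simp) (by simpa using hv)
  have h3 := H (d * u, e * v) trivial (by simpa using hu) (by simpa using hv)
  simp only [map_mul] at h1 h2 h3
  have h4 := commutatorElement_mem_of_mul_left h1
  have h5 := mul_mem (inv_mem h2) h3
  rw [mul_inv_rev, inv_inv, mul_assoc, mul_inv_cancel_left] at h5
  have h6 := commutatorElement_mem_of_mul_left h5
  exact commutatorElement_mem_of_mul_right (mul_mem (inv_mem h4) h6)

theorem exists_forall_top_mem_hullCentralizer (h : CompatiblePair α β)
    [(closure (crossCommutators α β)).Normal] (hn : 0 < n)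
    (hXn : ∀ x ∈ crossCommutators α β, (conjugatesOf x).encard ≤ n) {c : ℕ}
    (hc : c = (n ^ n).factorial) :
    ∃ Y ⊆ crossCommutators α β, Y.encard ≤ (1 + c + c : ℕ) ∧ ∃ M : Subgroup G,
      M.IndexAtMost (c * c ^ c * c ^ c) ∧ ∀ g, ∀ v ∈ M,
        ⁅α g, β v⁆ ∈ hullCentralizer (closure (crossCommutators α β)) Y ∧
        ⁅α v, β g⁆ ∈ hullCentralizer (closure (crossCommutators α β)) Y := by
  obtain ⟨y, hy, U, hU, hUi, H⟩ := h.exists_forall_mem_hullCentralizer hn hXn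
  choose yl hyl Ul _ hUli hl using h.exists_forall_left_mem_hullCentralizer hn hXn
  choose yr hyr Ur _ hUri hr using h.exists_forall_right_mem_hullCentralizer hn hXn
  rw [← hc] at hUi hUli hUri
  have hc0 : 0 < c := hc ▸ Nat.factorial_pos _
  have hfin : Finite (G ⧸ U) := (Nat.card_ne_zero.mp hUi.1).2
  have hcard : Nat.card (G ⧸ U) ≤ c := hUi.2
  let Yl := Set.range fun i : G ⧸ U ↦ yl i.out
  let Yr := Set.range fun i : G ⧸ U ↦ yr i.out
  -- Writing g as a coset representative times u ∈ U, the representative is handled by `Yl` or `Yr`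
  -- and u by y.
  refine ⟨({y} ∪ Yl) ∪ Yr, ?_, ?_,
    (U ⊓ ⨅ i : G ⧸ U, Ul i.out) ⊓ ⨅ i : G ⧸ U, Ur i.out, ?_, ?_⟩
  · refine Set.union_subset (Set.union_subset (Set.singleton_subset_iff.mpr hy) ?_) ?_
    · rintro _ ⟨i, rfl⟩
      exact hyl _
    · rintro _ ⟨i, rfl⟩
      exact hyr _
  · push_cast
    exact (Set.encard_union_le _ _).trans (add_le_add ((Set.encard_union_le _ _).trans
      (add_le_add (Set.encard_singleton _).le (Set.encard_range_le_of_card_le _ hcard)))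
      (Set.encard_range_le_of_card_le _ hcard))
  · exact (hUi.inf ((IndexAtMost.iInf fun i : G ⧸ U ↦ hUli i.out).mono
      (Nat.pow_le_pow_right hc0 hcard))).inf
      ((IndexAtMost.iInf fun i : G ⧸ U ↦ hUri i.out).mono (Nat.pow_le_pow_right hc0 hcard))
  · intro g v hv
    obtain ⟨hv, hvr⟩ := mem_inf.mp hv
    obtain ⟨hvU, hvl⟩ := mem_inf.mp hv
    rw [mem_iInf] at hvl hvr
    obtain ⟨i, u, hu, rfl⟩ := exists_eq_out_mul U g
    rw [map_mul, map_mul]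
    have hy' : ({y} : Set K) ⊆ ({y} ∪ Yl) ∪ Yr :=
      Set.subset_union_left.trans Set.subset_union_left
    have hl' : {yl i.out} ⊆ ({y} ∪ Yl) ∪ Yr := Set.singleton_subset_iff.mpr
      (Or.inl (Or.inr ⟨i, rfl⟩))
    have hr' : {yr i.out} ⊆ ({y} ∪ Yl) ∪ Yr := Set.singleton_subset_iff.mpr (Or.inr ⟨i, rfl⟩)
    exact ⟨commutatorElement_mul_left_mem (hullCentralizer_mono hl' (hl _ v (hvl i)))
        (hullCentralizer_mono hy' (H u hu v hvU)),
      commutatorElement_mul_right_mem (hullCentralizer_mono hr' (hr _ v (hvr i)))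
        (hullCentralizer_mono hy' (H v hvU u hu))⟩

/-- If all `⁅α a, β b⁆` have at most `n` conjugates, then the subgroup generated by these
commutators has finite derived subgroup, of order bounded in terms of `n`. -/
theorem exists_encard_commutator_le (hn : 0 < n) :
    ∃ C : ℕ, ∀ {K G : Type*} [Group K] [Group G] {α β : G →* K}, CompatiblePair α β →
      (∀ x ∈ crossCommutators α β, (conjugatesOf x).encard ≤ n) →
      ((⁅closure (crossCommutators α β), closure (crossCommutators α β)⁆ : Subgroup K) :
        Set K).encard ≤ C := by
  obtain ⟨c, hc⟩ : ∃ c, c = (n ^ n).factorial := ⟨_, rfl⟩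
  obtain ⟨m, hm⟩ : ∃ m, m = c * c ^ c * c ^ c := ⟨_, rfl⟩
  obtain ⟨s, hs⟩ : ∃ s, s = 1 + c + c + m * m := ⟨_, rfl⟩
  refine ⟨cardCommutatorBound (n ^ (s * n * n + s * n) * n ^ (s * n * n + s * n)), ?_⟩
  intro K G _ _ α β h hXn
  have := h.normal_closure
  obtain ⟨Y, hYX, hY, M, hMi, hM⟩ := h.exists_forall_top_mem_hullCentralizer hn hXn hc
  rw [← hm] at hMi
  have hfin : Finite (G ⧸ M) := (Nat.card_ne_zero.mp hMi.1).2
  have hcard : Nat.card ((G ⧸ M) × (G ⧸ M)) ≤ m * m := by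
    rw [Nat.card_prod]
    exact Nat.mul_le_mul hMi.2 hMi.2
  -- Up to factors with an entry in M, every cross commutator is one of these m * m. Adjoining them
  -- to Y makes the closure abelian modulo the hull.
  let f : (G ⧸ M) × (G ⧸ M) → K := fun i ↦ ⁅α i.1.out, β i.2.out⁆
  have hX : crossCommutators α β ⊆
      hullCentralizer (closure (crossCommutators α β)) (Y ∪ Set.range f) := by
    rintro _ ⟨a, b, rfl⟩
    have hY' : Y ⊆ Y ∪ Set.range f := Set.subset_union_left
    obtain ⟨i, u, hu, rfl⟩ := exists_eq_out_mul M a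
    obtain ⟨j, v, hv, rfl⟩ := exists_eq_out_mul M b
    rw [map_mul α]
    refine commutatorElement_mul_left_mem ?_ (hullCentralizer_mono hY' (hM _ u hu).2)
    rw [map_mul β]
    exact commutatorElement_mul_right_mem (subset_hullCentralizer (Or.inr ⟨(i, j), rfl⟩))
      (hullCentralizer_mono hY' (hM _ v hv).1)
  have hle : ⁅closure (crossCommutators α β), closure (crossCommutators α β)⁆ ≤
      commutatorHull (closure (crossCommutators α β)) (Y ∪ Set.range f) :=
    commutator_le.mpr fun x hx y hy ↦
      mem_hullCentralizer.mp ((closure_le _).mpr hX hy) x hx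
  refine (Set.encard_le_encard hle).trans (encard_commutatorHull_le hn
    (fun x hx k ↦ h.conj_mem_crossCommutators hx k) hXn (Set.union_subset hYX ?_) ?_)
  · rintro _ ⟨i, rfl⟩
    exact ⟨_, _, rfl⟩
  · rw [hs, Nat.cast_add]
    exact (Set.encard_union_le _ _).trans
      (add_le_add hY (Set.encard_range_le_of_card_le _ hcard))

end CompatiblePair

/-! ### Subgroups commuting modulo a normal subgroup -/

namespace Subgroup

variable {K : Type*} [Group K]

theorem exists_eq_mul_of_mem_sup_of_commutator_eq_bot {A B : Subgroup K} (h : ⁅A, B⁆ = ⊥) {x : K}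
    (hx : x ∈ A ⊔ B) : ∃ a ∈ A, ∃ b ∈ B, a * b = x := by
  have hc : ∀ (a : A) (b : B), Commute (A.subtype a) (B.subtype b) := fun a b ↦
    (mem_centralizer_iff.mp (commutator_eq_bot_iff_le_centralizer.mp h a.2) b b.2).symm
  have hr := MonoidHom.noncommCoprod_range A.subtype B.subtype hc
  rw [range_subtype, range_subtype] at hr
  rw [← hr] at hx
  obtain ⟨⟨a, b⟩, rfl⟩ := hx
  exact ⟨a, a.2, b, b.2, rfl⟩

theorem commutator_sup_self_le_of_commutator_eq_bot {A B : Subgroup K} (h : ⁅A, B⁆ = ⊥) :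
    ⁅A ⊔ B, A ⊔ B⁆ ≤ ⁅A, A⁆ ⊔ ⁅B, B⁆ := by
  rw [commutator_le]
  intro x hx y hy
  obtain ⟨a, ha, b, hb, rfl⟩ := exists_eq_mul_of_mem_sup_of_commutator_eq_bot h hx
  obtain ⟨a', ha', b', hb', rfl⟩ := exists_eq_mul_of_mem_sup_of_commutator_eq_bot h hy
  have hc (u v : K) (hu : u ∈ A) (hv : v ∈ B) : u * v = v * u :=
    (mem_centralizer_iff.mp (commutator_eq_bot_iff_le_centralizer.mp h hu) v hv).symm
  have e : ⁅a * b, a' * b'⁆ = ⁅a, a'⁆ * ⁅b, b'⁆ := by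
    calc ⁅a * b, a' * b'⁆ = a * (b * a') * (b' * b⁻¹) * a⁻¹ * (b'⁻¹ * a'⁻¹) := by
          simp only [commutatorElement_def]; group
      _ = a * (a' * b) * (b' * b⁻¹) * a⁻¹ * (a'⁻¹ * b'⁻¹) := by
          rw [hc a' b ha' hb, hc a'⁻¹ b'⁻¹ (inv_mem ha') (inv_mem hb')]
      _ = a * a' * ((b * b' * b⁻¹) * (a⁻¹ * a'⁻¹)) * b'⁻¹ := by group
      _ = a * a' * ((a⁻¹ * a'⁻¹) * (b * b' * b⁻¹)) * b'⁻¹ := by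
          rw [hc (a⁻¹ * a'⁻¹) (b * b' * b⁻¹) (mul_mem (inv_mem ha) (inv_mem ha'))
            (mul_mem (mul_mem hb hb') (inv_mem hb))]
      _ = ⁅a, a'⁆ * ⁅b, b'⁆ := by
          simp only [commutatorElement_def]; group
  rw [e]
  exact mul_mem_sup (commutator_mem_commutator ha ha') (commutator_mem_commutator hb hb')

theorem map_mk'_commutator_eq_bot {A B N : Subgroup K} [N.Normal] (h : ⁅A, B⁆ ≤ N) :
    ⁅A.map (QuotientGroup.mk' N), B.map (QuotientGroup.mk' N)⁆ = ⊥ := by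
  rw [← map_commutator, map_eq_bot_iff, QuotientGroup.ker_mk']
  exact h

theorem commutator_sup_self_le {A B N : Subgroup K} [N.Normal] (h : ⁅A, B⁆ ≤ N) :
    ⁅A ⊔ B, A ⊔ B⁆ ≤ ⁅A, A⁆ ⊔ ⁅B, B⁆ ⊔ N := by
  have := commutator_sup_self_le_of_commutator_eq_bot (map_mk'_commutator_eq_bot h)
  rw [← map_sup, ← map_commutator, ← map_commutator, ← map_commutator, ← map_sup,
    map_le_iff_le_comap, comap_map_eq, QuotientGroup.ker_mk'] at this
  exact this

theorem exists_eq_mul_mul_of_mem_sup {A B N : Subgroup K} [N.Normal] (h : ⁅A, B⁆ ≤ N) {x : K}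
    (hx : x ∈ A ⊔ B ⊔ N) : ∃ a ∈ A, ∃ b ∈ B, ∃ m ∈ N, a * b * m = x := by
  obtain ⟨y, hy, m, hm, rfl⟩ := mem_sup_of_normal_right.mp hx
  have hy' := mem_map_of_mem (QuotientGroup.mk' N) hy
  rw [map_sup] at hy'
  obtain ⟨_, ⟨a, ha, rfl⟩, _, ⟨b, hb, rfl⟩, e⟩ :=
    exists_eq_mul_of_mem_sup_of_commutator_eq_bot (map_mk'_commutator_eq_bot h) hy'
  rw [← map_mul] at e
  have e' := QuotientGroup.eq.mp e
  exact ⟨a, ha, b, hb, (a * b)⁻¹ * y * m, mul_mem e' hm, by group⟩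

/-- The elements of `K` which commute with all elements of `S` modulo `N`. -/
def centralizerMod (N : Subgroup K) [N.Normal] (S : Set K) : Subgroup K :=
  (centralizer (QuotientGroup.mk' N '' S)).comap (QuotientGroup.mk' N)

theorem mem_centralizerMod {N : Subgroup K} [N.Normal] {S : Set K} {k : K} :
    k ∈ centralizerMod N S ↔ ∀ s ∈ S, ⁅k, s⁆ ∈ N := by
  simp only [centralizerMod, mem_comap, mem_centralizer_iff, Set.forall_mem_image]
  refine forall₂_congr fun s _ ↦ ?_
  rw [eq_comm, ← commutatorElement_eq_one_iff_mul_comm, ← map_commutatorElement]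
  exact QuotientGroup.eq_one_iff _

end Subgroup

/-! ### Second derived subgroup of a compatible pair -/

namespace CompatiblePair

open Subgroup

variable {K G : Type*} [Group K] [Group G] {α β : G →* K}

theorem symm (h : CompatiblePair α β) : CompatiblePair β α where
  conj_left a b c := by
    have := congrArg (·⁻¹) (h.conj_right b a c)
    simpa only [mul_inv_rev, inv_inv, commutatorElement_inv, mul_assoc] using this
  conj_right a b c := by
    have := congrArg (·⁻¹) (h.conj_left b a c)
    simpa only [mul_inv_rev, inv_inv, commutatorElement_inv, mul_assoc] using this
  range_sup_range := by rw [sup_comm, h.range_sup_range]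

theorem closure_crossCommutators_swap :
    closure (crossCommutators β α) = closure (crossCommutators α β) := by
  have key (α β : G →* K) : closure (crossCommutators β α) ≤ closure (crossCommutators α β) := by
    rw [closure_le]
    rintro _ ⟨a, b, rfl⟩
    rw [← commutatorElement_inv]
    exact inv_mem (subset_closure ⟨b, a, rfl⟩)
  exact le_antisymm (key _ _) (key _ _)

/-- On the range of `β`, conjugation by `⁅α a, β c⁆` agrees with conjugation by `α ⁅a, c⁆`. -/
theorem mul_inv_commutator_mem_centralizer_range (h : CompatiblePair α β) (a c : G) :
    α ⁅a, c⁆ * ⁅α a, β c⁆⁻¹ ∈ centralizer (β.range : Set K) := by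
  rw [mem_centralizer_iff]
  rintro _ ⟨b, rfl⟩
  -- Conjugating by β d gives ⁅β d * α a * (β d)⁻¹, β b⁆ = ⁅α (d * a * d⁻¹), β b⁆. So the quotient
  -- of the two left entries commutes with β b, and this choice of d makes it the required element.
  set d := a * c * a⁻¹ with hd
  have h1 := h.conj_right a (d⁻¹ * b * d) d
  rw [conjugate_commutatorElement, ← map_inv, ← map_mul, ← map_mul,
    show d * (d⁻¹ * b * d) * d⁻¹ = b by group] at h1
  have h2 : α ⁅a, c⁆ * ⁅α a, β c⁆⁻¹ = (α (d * a * d⁻¹))⁻¹ * (β d * α a * β d⁻¹) := by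
    have h3 := h.conj_left a c a
    rw [show a * a * a⁻¹ = a by group, ← hd] at h3
    have h4 : ⁅α a, β c⁆ = (α a)⁻¹ * ⁅α a, β d⁆ * α a := by rw [← h3]; group
    rw [h4, hd]
    simp only [commutatorElement_def, map_mul, map_inv]
    group
  rw [h2]
  have h5 := congrArg
    (fun z ↦ (α (d * a * d⁻¹))⁻¹ * z * β b * (β d * α a * β d⁻¹)) h1
  simp only [commutatorElement_def] at h5
  group at h5 ⊢
  exact h5.symm

/-- α ⁅a, b⁆ acts on the closure as ⁅α a, β b⁆ does, and the latter lies in the closure, which is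
abelian modulo M. -/
theorem map_commutator_le_centralizerMod (h : CompatiblePair α β) {M : Subgroup K} [M.Normal]
    (hM : ⁅closure (crossCommutators α β), closure (crossCommutators α β)⁆ ≤ M) :
    (_root_.commutator G).map α ≤ centralizerMod M (closure (crossCommutators α β)) := by
  rw [map_le_iff_le_comap, _root_.commutator_def, commutator_le]
  intro a _ b _
  have hc := h.inv_mul_commutator_mem_centralizer a b
  have ht : ⁅α a, β b⁆ ∈ centralizerMod M (closure (crossCommutators α β) : Set K) :=
    mem_centralizerMod.mpr fun u hu ↦
      hM (commutator_mem_commutator (subset_closure ⟨a, b, rfl⟩) hu)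
  have hc' : (α ⁅a, b⁆)⁻¹ * ⁅α a, β b⁆ ∈
      centralizerMod M (closure (crossCommutators α β) : Set K) :=
    mem_centralizerMod.mpr fun u hu ↦ by
      rw [commutatorElement_eq_one_iff_mul_comm.mpr (mem_centralizer_iff.mp hc u hu).symm]
      exact one_mem _
  have := mul_mem ht (inv_mem hc')
  rw [mul_inv_rev, inv_inv, mul_inv_cancel_left] at this
  exact this

/-- α ⁅a, b⁆ is ⁅α a, β b⁆ times an element centralizing the range of β, and cross commutators
commute with β(G') modulo M. -/
theorem commutator_map_commutator_le (h : CompatiblePair α β) {M : Subgroup K} [M.Normal]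
    (hM : ⁅closure (crossCommutators α β), closure (crossCommutators α β)⁆ ≤ M) :
    ⁅(_root_.commutator G).map α, (_root_.commutator G).map β⁆ ≤ M := by
  have hβ : (_root_.commutator G).map β ≤ centralizerMod M (closure (crossCommutators α β)) := by
    have := h.symm.map_commutator_le_centralizerMod (M := M)
      (by rw [closure_crossCommutators_swap]; exact hM)
    rwa [closure_crossCommutators_swap] at this
  suffices H : (_root_.commutator G).map α ≤ centralizerMod M ((_root_.commutator G).map β) from
    commutator_le.mpr fun x hx y hy ↦ mem_centralizerMod.mp (H hx) y hy
  rw [map_le_iff_le_comap, _root_.commutator_def, commutator_le]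
  intro a _ b _
  have hc := h.mul_inv_commutator_mem_centralizer_range a b
  have ht : ⁅α a, β b⁆ ∈ centralizerMod M ((_root_.commutator G).map β : Set K) :=
    mem_centralizerMod.mpr fun u hu ↦ by
      have := mem_centralizerMod.mp (hβ hu) _ (subset_closure ⟨a, b, rfl⟩)
      rw [← commutatorElement_inv]
      exact inv_mem this
  have hc' : α ⁅a, b⁆ * ⁅α a, β b⁆⁻¹ ∈ centralizerMod M ((_root_.commutator G).map β : Set K) :=
    mem_centralizerMod.mpr fun u hu ↦ by
      obtain ⟨g, -, rfl⟩ := hu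
      rw [commutatorElement_eq_one_iff_mul_comm.mpr (mem_centralizer_iff.mp hc _ ⟨g, rfl⟩).symm]
      exact one_mem _
  have := mul_mem hc' ht
  rwa [inv_mul_cancel_right] at this

theorem derivedSeries_two_le (h : CompatiblePair α β) {M : Subgroup K} [M.Normal]
    (hM : ⁅closure (crossCommutators α β), closure (crossCommutators α β)⁆ ≤ M) :
    derivedSeries K 2 ≤ (derivedSeries G 2).map α ⊔ (derivedSeries G 2).map β ⊔ M := by
  have hN := h.normal_closure
  set H := closure (crossCommutators α β) with hH
  set A := (_root_.commutator G).map α with hA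
  set B := (_root_.commutator G).map β with hB
  have h1 : derivedSeries K 1 ≤ A ⊔ B ⊔ H := by
    rw [derivedSeries_one, _root_.commutator_def, ← h.range_sup_range]
    have hr : ⁅α.range, β.range⁆ ≤ H := by
      rw [commutator_le]
      rintro _ ⟨a, rfl⟩ _ ⟨b, rfl⟩
      exact subset_closure ⟨a, b, rfl⟩
    refine (commutator_sup_self_le hr).trans (le_of_eq ?_)
    rw [MonoidHom.range_eq_map, MonoidHom.range_eq_map, ← map_commutator, ← map_commutator]
    rfl
  have hAH : A ≤ centralizerMod M H := h.map_commutator_le_centralizerMod hM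
  have hBH : B ≤ centralizerMod M H := by
    have := h.symm.map_commutator_le_centralizerMod (M := M)
      (by rw [closure_crossCommutators_swap]; exact hM)
    rwa [closure_crossCommutators_swap] at this
  have hABH : ⁅A ⊔ B, H⁆ ≤ M := commutator_le.mpr fun x hx y hy ↦
    mem_centralizerMod.mp (sup_le hAH hBH hx) y hy
  have hAB : ⁅A, B⁆ ≤ M := h.commutator_map_commutator_le hM
  have h2 : derivedSeries G 2 = ⁅_root_.commutator G, _root_.commutator G⁆ := by
    rw [derivedSeries_succ, derivedSeries_one]
  rw [h2, map_commutator, map_commutator, derivedSeries_succ]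
  refine (commutator_mono h1 h1).trans ((commutator_sup_self_le hABH).trans ?_)
  exact sup_le (sup_le (commutator_sup_self_le hAB) (hM.trans le_sup_right)) le_sup_right

theorem card_derivedSeries_two_le (h : CompatiblePair α β) {c d : ℕ}
    (hc : (derivedSeries G 2 : Set G).encard ≤ c)
    (hd : ((⁅closure (crossCommutators α β), closure (crossCommutators α β)⁆ : Subgroup K) :
      Set K).encard ≤ d) :
    Finite (derivedSeries K 2) ∧ Nat.card (derivedSeries K 2) ≤ c * c * d := by
  have hN := h.normal_closure
  set M := ⁅closure (crossCommutators α β), closure (crossCommutators α β)⁆ with hM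
  have hcf : (derivedSeries G 2 : Set G).Finite := Set.finite_of_encard_le_coe hc
  have hdf : (M : Set K).Finite := Set.finite_of_encard_le_coe hd
  have : Finite (derivedSeries G 2) := hcf
  have : Finite M := hdf
  rw [← hcf.cast_ncard_eq] at hc
  rw [← hdf.cast_ncard_eq] at hd
  have hc' : Nat.card (derivedSeries G 2) ≤ c := by exact_mod_cast hc
  have hd' : Nat.card M ≤ d := by exact_mod_cast hd
  let f : (derivedSeries G 2 × derivedSeries G 2) × M → K := fun p ↦
    α p.1.1 * β p.1.2 * p.2
  have hsub : (derivedSeries K 2 : Set K) ⊆ Set.range f := by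
    intro x hx
    have hle : derivedSeries G 2 ≤ _root_.commutator G :=
      derivedSeries_one G ▸ derivedSeries_antitone G one_le_two
    have hcom : ⁅(derivedSeries G 2).map α, (derivedSeries G 2).map β⁆ ≤ M :=
      (commutator_mono (map_mono hle) (map_mono hle)).trans
        (h.commutator_map_commutator_le le_rfl)
    obtain ⟨_, ⟨a, ha, rfl⟩, _, ⟨b, hb, rfl⟩, m, hm, rfl⟩ :=
      exists_eq_mul_mul_of_mem_sup hcom (h.derivedSeries_two_le le_rfl hx)
    exact ⟨((⟨a, ha⟩, ⟨b, hb⟩), ⟨m, hm⟩), rfl⟩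
  refine ⟨(Set.finite_range f).subset hsub, ?_⟩
  calc Nat.card (derivedSeries K 2) ≤ Nat.card (Set.range f) :=
        Nat.card_mono (Set.finite_range f) hsub
    _ ≤ Nat.card ((derivedSeries G 2 × derivedSeries G 2) × M) := Finite.card_range_le f
    _ ≤ c * c * d := by
        rw [Nat.card_prod, Nat.card_prod]
        exact Nat.mul_le_mul (Nat.mul_le_mul hc' hc') hd'

/-- Here the cross commutators are the ordinary commutators, so the bound for compatible pairs
becomes a bound for G''. -/
theorem id_id (G : Type*) [Group G] : CompatiblePair (MonoidHom.id G) (MonoidHom.id G) where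
  conj_left a b c := conjugate_commutatorElement a b c
  conj_right a b c := conjugate_commutatorElement a b c
  range_sup_range := by
    rw [MonoidHom.range_eq_top.mpr Function.surjective_id, sup_idem]

end CompatiblePair

theorem closure_crossCommutators_id (G : Type*) [Group G] :
    Subgroup.closure (crossCommutators (MonoidHom.id G) (MonoidHom.id G)) = commutator G :=
  (commutator_eq_closure G).symm

/-! ### Application to ν(G) -/

namespace Rocco

theorem commR_eq {K : Type*} [Group K] (x y : K) : commR x y = ⁅x⁻¹, y⁻¹⁆ := by
  simp [commR, conjR, commutatorElement_def, mul_assoc]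

theorem map_conjR {K L : Type*} [Group K] [Group L] (f : K →* L) (x y : K) :
    f (conjR x y) = conjR (f x) (f y) := by
  simp [conjR]

theorem map_commR {K L : Type*} [Group K] [Group L] (f : K →* L) (x y : K) :
    f (commR x y) = commR (f x) (f y) := by
  simp [commR, map_conjR]

variable (G : Type*) [Group G]

theorem conjR_commR_left (a b c : G) : conjR (commR (ι G a) (φ G b)) (ι G c) =
    commR (ι G (conjR a c)) (φ G (conjR b c)) := by
  have := (QuotientGroup.eq_one_iff _).mpr
    (Subgroup.subset_normalClosure (show _ ∈ nuRels G from ⟨a, b, c, Or.inl rfl⟩))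
  change QuotientGroup.mk' _ _ = 1 at this
  rw [map_mul, map_inv, mul_inv_eq_one, map_conjR, map_commR, map_commR] at this
  exact this

theorem conjR_commR_right (a b c : G) : conjR (commR (ι G a) (φ G b)) (φ G c) =
    commR (ι G (conjR a c)) (φ G (conjR b c)) := by
  have := (QuotientGroup.eq_one_iff _).mpr
    (Subgroup.subset_normalClosure (show _ ∈ nuRels G from ⟨a, b, c, Or.inr rfl⟩))
  change QuotientGroup.mk' _ _ = 1 at this
  rw [map_mul, map_inv, mul_inv_eq_one, map_conjR, map_commR, map_commR] at this
  exact this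

theorem compatiblePair : CompatiblePair (ι G) (φ G) where
  conj_left a b c := by
    -- The inverses translate right conjugates and `commR` into left conjugates and ⁅·, ·⁆.
    have := conjR_commR_left G a⁻¹ b⁻¹ c⁻¹
    simpa [commR_eq, conjR, mul_assoc] using this
  conj_right a b c := by
    have := conjR_commR_right G a⁻¹ b⁻¹ c⁻¹
    simpa [commR_eq, conjR, mul_assoc] using this
  range_sup_range := by
    rw [ι, φ, MonoidHom.range_comp, MonoidHom.range_comp, ← Subgroup.map_sup,
      Monoid.Coprod.range_inl_sup_range_inr, ← MonoidHom.range_eq_map,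
      MonoidHom.range_eq_top.mpr (QuotientGroup.mk'_surjective _)]

theorem crossCommutators_subset_tensors : crossCommutators (ι G) (φ G) ⊆ tensors G := by
  rintro _ ⟨a, b, rfl⟩
  exact ⟨a⁻¹, b⁻¹, by simp [commR_eq]⟩

/-- The epimorphism `ν(G) → G` which restricts to the identity on both copies of `G`. -/
def fold : Nu G →* G :=
  QuotientGroup.lift _ (Monoid.Coprod.lift (MonoidHom.id G) (MonoidHom.id G)) <| by
    refine Subgroup.normalClosure_le_normal (N := MonoidHom.ker _) ?_
    rintro _ ⟨a, b, c, rfl | rfl⟩ <;>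
    · rw [SetLike.mem_coe, MonoidHom.mem_ker]
      simp [conjR, commR, mul_assoc]

theorem fold_ι (g : G) : fold G (ι G g) = g := by
  change Monoid.Coprod.lift (MonoidHom.id G) (MonoidHom.id G) (Monoid.Coprod.inl g) = g
  simp

theorem fold_φ (g : G) : fold G (φ G g) = g := by
  change Monoid.Coprod.lift (MonoidHom.id G) (MonoidHom.id G) (Monoid.Coprod.inr g) = g
  simp

variable {G}

/-- `fold` maps the conjugates of a tensor onto those of the corresponding commutator of G. -/
theorem encard_conjugatesOf_commutator_le {n : ℕ}
    (h : ∀ x ∈ tensors G, (conjugatesOf x).encard ≤ n) (a b : G) :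
    (conjugatesOf ⁅a, b⁆).encard ≤ n := by
  have hsub : conjugatesOf ⁅a, b⁆ ⊆ fold G '' conjugatesOf ⁅ι G a, φ G b⁆ := by
    intro y hy
    obtain ⟨k, rfl⟩ := isConj_iff.mp hy
    refine ⟨ι G k * ⁅ι G a, φ G b⁆ * (ι G k)⁻¹, isConj_iff.mpr ⟨_, rfl⟩, ?_⟩
    simp only [map_mul, map_inv, map_commutatorElement, fold_ι, fold_φ]
  exact ((Set.encard_le_encard hsub).trans (Set.encard_image_le _ _)).trans
    (h _ (crossCommutators_subset_tensors G ⟨a, b, rfl⟩))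

end Rocco

/-- There is a bound `f n`, depending on `n` only, such that for every group `G` in which all
tensors have at most `n` conjugates in `ν(G)`, the group `ν(G)''` is finite of order at
most `f n`. -/
theorem theoremA :
    ∃ f : ℕ → ℕ, ∀ n : ℕ, 0 < n → ∀ (G : Type*) [Group G],
      (∀ x ∈ Rocco.tensors G, (conjugatesOf x).encard ≤ n) →
        Finite (derivedSeries (Rocco.Nu G) 2) ∧
          Nat.card (derivedSeries (Rocco.Nu G) 2) ≤ f n := by
  have key (n : ℕ) : ∃ c : ℕ, 0 < n → ∀ (G : Type _) [Group G],
      (∀ x ∈ Rocco.tensors G, (conjugatesOf x).encard ≤ n) →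
        Finite (derivedSeries (Rocco.Nu G) 2) ∧ Nat.card (derivedSeries (Rocco.Nu G) 2) ≤ c := by
    rcases Nat.eq_zero_or_pos n with rfl | hn
    · exact ⟨0, fun h ↦ absurd h (lt_irrefl 0)⟩
    obtain ⟨C, hC⟩ := CompatiblePair.exists_encard_commutator_le hn
    refine ⟨C * C * C, fun _ G _ h ↦ (Rocco.compatiblePair G).card_derivedSeries_two_le ?_
      (hC (Rocco.compatiblePair G) fun x hx ↦ h x (Rocco.crossCommutators_subset_tensors G hx))⟩
    have hG := hC (CompatiblePair.id_id G) <| by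
      rintro _ ⟨a, b, rfl⟩
      exact Rocco.encard_conjugatesOf_commutator_le h a b
    rwa [closure_crossCommutators_id, ← derivedSeries_one, ← derivedSeries_succ] at hG
  choose f hf using key
  exact ⟨f, hf⟩
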